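/- A *metric triangle* is a metric space $(\triangle,d)$ that is the union of three edges $I_1,I_2,I_3$, with isometries $\varphi_j\colon[0,\ell_j]\to I_j$ ($\ell_j\ge 0$) onto the edges such that $\varphi_j(\ell_j)=\varphi_{j+1}(0)$ for $j=1,2,3$ (indices modulo $3$). Write $p=\varphi_1(0)$, $q=\varphi_2(0)$, $r=\varphi_3(0)$, so that $I_1,I_2,I_3$ join $p$ to $q$, $q$ to $r$ and $r$ to $p$, respectively, and let $\widehat I_j$ be the union of the two edges other than $I_j$. Let $(x\cdot y)_z=\frac12\bigl(d(x,z)+d(y,z)-d(x,y)\bigr)$ be the Gromov product, and let $l_1=(q\cdot r)_p$, $l_2=(r\cdot p)_q$, $l_3=(p\cdot q)_r$. Put $e_1=(1,0)$, $e_2=(-\frac12,\frac{\sqrt3}2)$, $e_3=(-\frac12,-\frac{\sqrt3}2)$ and $v_1=(\frac12,\frac{\sqrt3}2)$, $v_2=(-1,0)$, $v_3=(\frac12,-\frac{\sqrt3}2)$. For $x=\varphi_j(s)\in I_j$ let $\bar x=(l_j-s)e_j$ if $s\le l_j$ and $\bar x=(s-l_j)e_{j+1}$ if $s> l_j$; that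 is, $x\mapsto\bar x$ maps $I_j$ by arc length onto the union of the segments from $l_je_j$ to the origin and from the origin to $l_{j+1}e_{j+1}$. **Theorem.** For every metric triangle $\triangle$ the *tripodal embedding* $$F\colon\triangle\to\mathbb R^2,\qquad F(x)=\bar x+\operatorname{dist}(x,\widehat I_j)\,v_j\quad\text{if } x\in I_j,$$ is well defined and bi-Lipschitz with respect to $d$ and the Euclidean metric, and its distortion is at most $4\sqrt{7/3}$. Here the distortion of a bi-Lipschitz map $f$ is $L_0L_1$, where $L_0,L_1$ are the infima of the constants for which $L_0^{-1}d(x,y)\le\|f(x)-f(y)\|\le L_1d(x,y)$ holds for all $x,y$. -/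

import Mathlib

/-- The structure of a metric `n`-gon on a metric space `X`: `X` is the union of `n` edges, the
`j`-th edge is the image of an isometric parametrization `param j` of the interval `[0, len j]`
(the values of `param j` outside this interval play no role), and the edges are joined cyclically
at their endpoints (indices are taken modulo `n`). -/
structure MetricPolygon (n : ℕ) [NeZero n] (X : Type*) [MetricSpace X] where
  len : Fin n → ℝ
  len_nonneg : ∀ j, 0 ≤ len j
  param : Fin n → ℝ → X
  dist_param : ∀ j, ∀ s ∈ Set.Icc 0 (len j), ∀ t ∈ Set.Icc 0 (len j),
    dist (param j s) (param j t) = |s - t|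
  joined : ∀ j, param j (len j) = param (j + 1) 0
  cover : ∀ x, ∃ j, ∃ s ∈ Set.Icc 0 (len j), param j s = x

/-- A metric triangle is a metric `3`-gon. -/
abbrev MetricTriangle (X : Type*) [MetricSpace X] := MetricPolygon 3 X

/-- The Gromov product `(p · q)_r`. -/
noncomputable def gromovProduct {X : Type*} [MetricSpace X] (p q r : X) : ℝ :=
  (dist p r + dist q r - dist p q) / 2

/-- `f` is bi-Lipschitz. -/
def IsBiLipschitz {X Y : Type*} [MetricSpace X] [MetricSpace Y] (f : X → Y) : Prop :=
  ∃ L : ℝ, 0 < L ∧ ∀ x y, L⁻¹ * dist x y ≤ dist (f x) (f y) ∧ dist (f x) (f y) ≤ L * dist x y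

/-- The distortion `L₀ * L₁` of a bi-Lipschitz map, where `L₀` and `L₁` are the best constants
with `L₀⁻¹ d(x, y) ≤ d(f x, f y) ≤ L₁ d(x, y)`. -/
noncomputable def distortion {X Y : Type*} [MetricSpace X] [MetricSpace Y] (f : X → Y) : ℝ :=
  sInf {L : ℝ | 0 < L ∧ ∀ x y, L⁻¹ * dist x y ≤ dist (f x) (f y)} *
    sInf {L : ℝ | 0 < L ∧ ∀ x y, dist (f x) (f y) ≤ L * dist x y}

/-- The unit directions of the three legs of the embedded tripod. -/
noncomputable def legDirection : Fin 3 → EuclideanSpace ℝ (Fin 2) :=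
  ![!₂[1, 0], !₂[-1 / 2, √3 / 2], !₂[-1 / 2, -(√3 / 2)]]

/-- The directions `v₁, v₂, v₃`, along which the points of the three edges are displaced. -/
noncomputable def edgeDirection : Fin 3 → EuclideanSpace ℝ (Fin 2) :=
  ![!₂[1 / 2, √3 / 2], !₂[-1, 0], !₂[1 / 2, -(√3 / 2)]]

namespace MetricPolygon

variable {X : Type*} [MetricSpace X] (T : MetricTriangle X)

/-- The `j`-th edge. -/
def edge (j : Fin 3) : Set X := T.param j '' Set.Icc 0 (T.len j)

/-- The union of the two edges other than the `j`-th one. -/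
def otherEdges (j : Fin 3) : Set X := T.edge (j + 1) ∪ T.edge (j + 2)

/-- The vertices `p, q, r`, for `j = 0, 1, 2`. The `j`-th edge runs from vertex `j` to vertex
`j + 1`, so the edges are `[pq]`, `[qr]`, `[rp]`. -/
def vertex (j : Fin 3) : X := T.param j 0

/-- The length of the `j`-th leg of the tripod associated to the triangle: the Gromov product, at
the `j`-th vertex, of the other two vertices. -/
noncomputable def legLength (j : Fin 3) : ℝ :=
  gromovProduct (T.vertex (j + 1)) (T.vertex (j + 2)) (T.vertex j)

/-- The image `x̄` in the plane of a point `x` of the `j`-th edge under the projection to the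
associated tripod, followed by the embedding of this tripod. The edge is traced by arc length: the
`j`-th vertex goes to the tip of the `j`-th leg, the path follows this leg to the origin, and then
follows the `(j + 1)`-st leg from the origin to its tip. -/
noncomputable def tripodPoint (j : Fin 3) (x : X) : EuclideanSpace ℝ (Fin 2) :=
  if dist (T.vertex j) x ≤ T.legLength j then
    (T.legLength j - dist (T.vertex j) x) • legDirection j
  else
    (dist (T.vertex j) x - T.legLength j) • legDirection (j + 1)

/-- `F` is the tripodal embedding: `F x = x̄ + dist (x, Î_j) v_j` whenever `x` is a point of the
`j`-th edge. There is at most one such map, because the edges cover the triangle. -/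
def IsTripodalEmbedding (F : X → EuclideanSpace ℝ (Fin 2)) : Prop :=
  ∀ j, ∀ x ∈ T.edge j,
    F x = T.tripodPoint j x + Metric.infDist x (T.otherEdges j) • edgeDirection j

end MetricPolygon

/-! Since the `e_j` sum to zero and `v_j = e_j + e_{j+1}`, the difference of any two image points is
`u e_j + v e_{j+1}`, of squared norm `u² + v² - uv`. With `D = d(x, y)`, it suffices to bound this
form between `3D²/16` and `7D²`; then `L₀ ≤ 4/√3` and `L₁ ≤ √7`.

Two points on one edge are easy: `|u - v| = D`. For adjacent edges, let `c, c'` be the signed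
positions and `h, k` the distances to the other edges. The triangle inequality gives `|c + c'| ≤ D`
and `c - c' ≤ D`, so the tripod projection is 1-Lipschitz; with `h, k ≤ D` this yields the upper
bound. Conversely, following `x` and `y` to nearest points on the other edges bounds `D` from above
in terms of `c, c', h, k`, which forces one of `|u|, |v|, |u - v|` to be at least `D/2`
(`le_two_mul_abs_of_adjacent`).

The upper bound holds for any choice of edges containing the two points, so taking `x = y` shows
that `F` is well defined. -/

/-! ### Planar geometry and real inequalities -/

theorem edgeDirection_eq_add (j : Fin 3) :
    edgeDirection j = legDirection j + legDirection (j + 1) := by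
  fin_cases j <;> ext i <;> fin_cases i <;>
    simp [edgeDirection, legDirection] <;> ring

theorem legDirection_add_two (j : Fin 3) :
    legDirection (j + 2) = -(legDirection j + legDirection (j + 1)) := by
  fin_cases j <;> ext i <;> fin_cases i <;>
    simp [legDirection] <;> ring

theorem norm_sq_smul_legDirection_add (j : Fin 3) (u v : ℝ) :
    ‖u • legDirection j + v • legDirection (j + 1)‖ ^ 2 = u ^ 2 + v ^ 2 - u * v := by
  have h3 : √3 ^ 2 = (3 : ℝ) := Real.sq_sqrt (by norm_num)
  rw [EuclideanSpace.norm_sq_eq]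
  fin_cases j <;> simp [legDirection, Fin.sum_univ_two] <;> ring_nf <;> rw [h3] <;> ring

/-- Four times the form equals `3u² + (u - 2v)²`, `3v² + (v - 2u)²` and `3(u - v)² + (u + v)²`. -/
theorem sq_add_sq_sub_mul_ge {u v D : ℝ} (hD : 0 ≤ D)
    (h : D ≤ 2 * |u| ∨ D ≤ 2 * |v| ∨ D ≤ 2 * |u - v|) :
    (√3 / 4 * D) ^ 2 ≤ u ^ 2 + v ^ 2 - u * v := by
  have h3 : √3 ^ 2 = (3 : ℝ) := Real.sq_sqrt (by norm_num)
  have key (w : ℝ) (hw : D ≤ 2 * |w|) : D ^ 2 ≤ 4 * w ^ 2 := by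
    have := pow_le_pow_left₀ hD hw 2
    rwa [mul_pow, sq_abs, show (2 : ℝ) ^ 2 = 4 by norm_num] at this
  have e : (√3 / 4 * D) ^ 2 = 3 / 16 * D ^ 2 := by rw [mul_pow, div_pow, h3]; norm_num
  rw [e]
  rcases h with h | h | h
  · nlinarith [key _ h, sq_nonneg (u - 2 * v)]
  · nlinarith [key _ h, sq_nonneg (v - 2 * u)]
  · nlinarith [key _ h, sq_nonneg (u + v)]

/-- The linear estimates behind the bi-Lipschitz bounds for points on different edges: here `c`
and `c'` are the signed positions of the two points on their edges, `h` and `k` their distances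
from the other edges, and `D` is their mutual distance. -/
theorem le_two_mul_abs_of_adjacent {c c' h k D z w : ℝ} (hh : 0 ≤ h) (hk : 0 ≤ k)
    (hz : D ≤ 2 * h + |c + c'| ∨ |z + c| ≤ h ∧ z - c ≤ h)
    (hw : D ≤ 2 * k + |c + c'| ∨ |c' + w| ≤ k ∧ c' - w ≤ k)
    (hzw : D ≤ 2 * h + |c + c'| ∨ D ≤ 2 * k + |c + c'| ∨ D ≤ h + k + |z - w|) :
    D ≤ 2 * |max c 0 + max (-c') 0 + h + k| ∨
      D ≤ 2 * |max (-c) 0 - max c' 0 + max (-c') 0 + h| ∨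
      D ≤ 2 * |max c 0 + max (-c') 0 + h + k - (max (-c) 0 - max c' 0 + max (-c') 0 + h)| := by
  by_contra! hlt
  obtain ⟨hu, hv, hd⟩ := hlt
  have hu' : max c 0 + max (-c') 0 + h + k < D / 2 := by
    linarith [le_abs_self (max c 0 + max (-c') 0 + h + k)]
  have hv' := abs_lt.1 (show |max (-c) 0 - max c' 0 + max (-c') 0 + h| < D / 2 by linarith)
  have hd' := abs_lt.1 (show |max c 0 + max (-c') 0 + h + k -
    (max (-c) 0 - max c' 0 + max (-c') 0 + h)| < D / 2 by linarith)
  clear hu hv hd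
  -- Fixing all signs makes the problem linear. The second alternatives in `hz` and `hw` contain `-c
  -- ≤ h` and `c' ≤ k`, by eliminating `z` and `w`.
  rcases le_total c 0 with hc | hc <;> rcases le_total c' 0 with hc' | hc' <;>
    simp only [max_eq_left, max_eq_right, hc, hc', neg_nonneg, neg_nonpos] at hu' hv' hd' <;>
    rcases abs_cases (c + c') with ⟨e, _⟩ | ⟨e, _⟩ <;> rw [e] at hz hw hzw <;>
    rw [abs_le] at hz hw <;>
    rcases hzw with hzw | hzw | hzw <;> rcases hz with hz | hz <;> rcases hw with hw | hw <;>
    first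
    | linarith
    | rcases abs_cases (z - w) with ⟨e', _⟩ | ⟨e', _⟩ <;> linarith

theorem sq_add_sq_sub_mul_le_of_adjacent {c c' h k D : ℝ} (hh : 0 ≤ h) (hk : 0 ≤ k)
    (hhD : h ≤ D) (hkD : k ≤ D) (hs : |c + c'| ≤ D) (hd : c - c' ≤ D) :
    (max c 0 + max (-c') 0 + h + k) ^ 2 + (max (-c) 0 - max c' 0 + max (-c') 0 + h) ^ 2 -
      (max c 0 + max (-c') 0 + h + k) * (max (-c) 0 - max c' 0 + max (-c') 0 + h) ≤
      7 * D ^ 2 := by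
  obtain ⟨u, hu⟩ : ∃ u, u = max c 0 + max (-c') 0 + h + k := ⟨_, rfl⟩
  obtain ⟨v, hv⟩ : ∃ v, v = max (-c) 0 - max c' 0 + max (-c') 0 + h := ⟨_, rfl⟩
  rw [← hu, ← hv]
  have hs' := abs_le.1 hs
  obtain ⟨h0, h1, h2, h3⟩ : 0 ≤ u ∧ u ≤ 3 * D ∧ v ≤ 2 * D ∧ u - v ≤ 2 * D := by
    rcases le_total c 0 with hc | hc <;> rcases le_total c' 0 with hc' | hc' <;>
      simp only [max_eq_left, max_eq_right, hc, hc', neg_nonneg, neg_nonpos] at hu hv <;>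
      refine ⟨?_, ?_, ?_, ?_⟩ <;> linarith
  have hD : 0 ≤ D := hh.trans hhD
  -- `(2D - v)(2D - u + v) ≥ 0` bounds the form by `u² - 2Du + 4D²`, and `u² ≤ 3Du` with `u ≤ 3D`
  -- bounds this by `7D²`.
  nlinarith [mul_nonneg (sub_nonneg.2 h2) (sub_nonneg.2 h3), mul_nonneg h0 (sub_nonneg.2 h1),
    mul_nonneg hD (sub_nonneg.2 h1)]

/-! ### Signed coordinates on the edges -/

namespace MetricPolygon

variable {X : Type*} [MetricSpace X] (T : MetricTriangle X)

/-- The signed position of a point `x` of the `j`-th edge with respect to the point of that edge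
which is mapped to the centre of the tripod; it is positive on the side of the `j`-th vertex. -/
noncomputable def legCoord (j : Fin 3) (x : X) : ℝ := T.legLength j - dist (T.vertex j) x

/-- The image of a point of the `j`-th edge under the tripodal embedding. -/
noncomputable def tripodalImage (j : Fin 3) (x : X) : EuclideanSpace ℝ (Fin 2) :=
  T.tripodPoint j x + Metric.infDist x (T.otherEdges j) • edgeDirection j

variable {T} {j : Fin 3} {x y : X}

theorem vertex_mem_edge : T.vertex j ∈ T.edge j :=
  ⟨0, ⟨le_rfl, T.len_nonneg j⟩, rfl⟩

theorem dist_vertex_param {s : ℝ} (hs : s ∈ Set.Icc 0 (T.len j)) :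
    dist (T.vertex j) (T.param j s) = s := by
  rw [vertex, T.dist_param j 0 ⟨le_rfl, T.len_nonneg j⟩ s hs, zero_sub, abs_neg,
    abs_of_nonneg hs.1]

theorem dist_vertex_vertex_add_one : dist (T.vertex j) (T.vertex (j + 1)) = T.len j := by
  rw [vertex.eq_1 T (j + 1), ← T.joined j]
  exact dist_vertex_param ⟨T.len_nonneg j, le_rfl⟩

theorem dist_add_dist_of_mem_edge (hx : x ∈ T.edge j) :
    dist (T.vertex j) x + dist (T.vertex (j + 1)) x = dist (T.vertex j) (T.vertex (j + 1)) := by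
  obtain ⟨s, hs, rfl⟩ := hx
  rw [dist_vertex_vertex_add_one, dist_vertex_param hs, vertex, ← T.joined j,
    T.dist_param j _ ⟨T.len_nonneg j, le_rfl⟩ s hs, abs_of_nonneg (sub_nonneg.2 hs.2)]
  ring

theorem dist_eq_of_mem_edge (hx : x ∈ T.edge j) (hy : y ∈ T.edge j) :
    dist x y = |T.legCoord j x - T.legCoord j y| := by
  obtain ⟨s, hs, rfl⟩ := hx
  obtain ⟨t, ht, rfl⟩ := hy
  rw [legCoord, legCoord, dist_vertex_param hs, dist_vertex_param ht, T.dist_param j s hs t ht,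
    abs_sub_comm]
  ring_nf

theorem add_one_add_two (j : Fin 3) : j + 1 + 2 = j := by fin_cases j <;> rfl
theorem add_two_add_one (j : Fin 3) : j + 2 + 1 = j := by fin_cases j <;> rfl
theorem add_one_add_one (j : Fin 3) : j + 1 + 1 = j + 2 := by fin_cases j <;> rfl

theorem legLength_add_legLength (j : Fin 3) :
    T.legLength j + T.legLength (j + 1) = dist (T.vertex j) (T.vertex (j + 1)) := by
  simp only [legLength, gromovProduct, add_one_add_one, add_one_add_two]
  rw [dist_comm (T.vertex (j + 1)) (T.vertex j),
    dist_comm (T.vertex (j + 2)) (T.vertex (j + 1)), dist_comm (T.vertex (j + 2)) (T.vertex j)]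
  ring

theorem dist_vertex_add_one_of_mem_edge (hx : x ∈ T.edge j) :
    dist (T.vertex (j + 1)) x = T.legLength (j + 1) + T.legCoord j x := by
  have h1 := dist_add_dist_of_mem_edge hx
  have h2 := T.legLength_add_legLength j
  rw [legCoord]
  linarith

/-- The sum is the difference of the distances of `x` and `y` from the common vertex `j + 1`; the
two edges run through its leg in opposite directions, hence the plus sign. -/
theorem abs_legCoord_add_legCoord_le (hx : x ∈ T.edge j) :
    |T.legCoord j x + T.legCoord (j + 1) y| ≤ dist x y := by
  have h1 := dist_vertex_add_one_of_mem_edge hx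
  have h2 := abs_dist_sub_le x y (T.vertex (j + 1))
  rw [dist_comm x, dist_comm y] at h2
  have : T.legCoord j x + T.legCoord (j + 1) y =
      dist (T.vertex (j + 1)) x - dist (T.vertex (j + 1)) y := by
    rw [h1, legCoord.eq_1 T (j + 1)]; ring
  rwa [this]

/-- Triangle inequality along the path from vertex `j` via `x` and `y` to vertex `j + 2`, whose
endpoints are `l_j + l_{j+2}` apart. -/
theorem legCoord_sub_legCoord_le (hy : y ∈ T.edge (j + 1)) :
    T.legCoord j x - T.legCoord (j + 1) y ≤ dist x y := by
  have h1 := dist_vertex_add_one_of_mem_edge hy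
  have h2 := T.legLength_add_legLength (j + 2)
  rw [add_one_add_one] at h1
  rw [add_two_add_one, dist_comm] at h2
  have h3 := dist_triangle4 (T.vertex j) x y (T.vertex (j + 2))
  rw [dist_comm y] at h3
  rw [legCoord.eq_1 T j]
  linarith

theorem tripodPoint_eq (j : Fin 3) (x : X) :
    T.tripodPoint j x = max (T.legCoord j x) 0 • legDirection j +
      max (-T.legCoord j x) 0 • legDirection (j + 1) := by
  rw [tripodPoint, legCoord]
  split_ifs with h
  · rw [max_eq_left (by linarith), max_eq_right (by linarith), zero_smul, add_zero]
  · rw [max_eq_right (by linarith), max_eq_left (by linarith), zero_smul, zero_add, neg_sub]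

theorem isCompact_edge (j : Fin 3) : IsCompact (T.edge j) := by
  refine isCompact_Icc.image_of_continuousOn (LipschitzOnWith.continuousOn (K := 1) ?_)
  refine LipschitzOnWith.of_dist_le_mul fun s hs t ht => ?_
  rw [T.dist_param j s hs t ht, NNReal.coe_one, one_mul, Real.dist_eq]

theorem exists_infDist_eq_dist (j : Fin 3) (x : X) :
    ∃ z, (z ∈ T.edge (j + 1) ∨ z ∈ T.edge (j + 2)) ∧
      Metric.infDist x (T.otherEdges j) = dist x z :=
  ((isCompact_edge (j + 1)).union (isCompact_edge (j + 2))).exists_infDist_eq_dist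
    ⟨_, Or.inl vertex_mem_edge⟩ x

/-! ### Distances between image points -/

/-- Go from `x` to `z`, then along the edge to `y`. The second piece is at most `|c + c'|` plus the
discrepancy between the positions of `z` and `x`, which is again at most `dist x z`. -/
theorem le_two_mul_dist_add_left (hx : x ∈ T.edge j) (hy : y ∈ T.edge (j + 1)) {z : X}
    (hz : z ∈ T.edge (j + 1)) :
    dist x y ≤ 2 * dist x z + |T.legCoord j x + T.legCoord (j + 1) y| := by
  have h1 := dist_triangle x z y
  have h2 := dist_eq_of_mem_edge hz hy
  have h3 := abs_legCoord_add_legCoord_le (y := z) hx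
  have h4 := abs_sub_le (T.legCoord (j + 1) z) (-T.legCoord j x) (T.legCoord (j + 1) y)
  rw [sub_neg_eq_add, add_comm (T.legCoord (j + 1) z), ← neg_add', abs_neg] at h4
  linarith

theorem le_two_mul_dist_add_right (hx : x ∈ T.edge j) {w : X} (hw : w ∈ T.edge j) :
    dist x y ≤ 2 * dist y w + |T.legCoord j x + T.legCoord (j + 1) y| := by
  have h1 := dist_triangle x w y
  have h2 := dist_eq_of_mem_edge hx hw
  have h3 := abs_legCoord_add_legCoord_le (y := y) hw
  have h4 := abs_sub_le (T.legCoord j x) (-T.legCoord (j + 1) y) (T.legCoord j w)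
  rw [sub_neg_eq_add, ← neg_add', abs_neg, add_comm (T.legCoord (j + 1) y)] at h4
  rw [dist_comm y w]
  linarith

/-- In the basis `e_j, e_{j+1}` one has `v_{j+1} = -e_j`, so the first coefficient is a sum of
nonnegative terms without cancellation. -/
theorem tripodalImage_sub_of_adjacent (j : Fin 3) (x y : X) :
    T.tripodalImage j x - T.tripodalImage (j + 1) y =
      (max (T.legCoord j x) 0 + max (-T.legCoord (j + 1) y) 0 +
        Metric.infDist x (T.otherEdges j) +
        Metric.infDist y (T.otherEdges (j + 1))) • legDirection j +
      (max (-T.legCoord j x) 0 - max (T.legCoord (j + 1) y) 0 +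
        max (-T.legCoord (j + 1) y) 0 +
        Metric.infDist x (T.otherEdges j)) • legDirection (j + 1) := by
  simp only [tripodalImage, tripodPoint_eq, edgeDirection_eq_add, add_one_add_one,
    legDirection_add_two]
  module

theorem tripodalImage_sub_of_same (j : Fin 3) (x y : X) :
    T.tripodalImage j x - T.tripodalImage j y =
      (max (T.legCoord j x) 0 - max (T.legCoord j y) 0 +
        (Metric.infDist x (T.otherEdges j) - Metric.infDist y (T.otherEdges j))) •
          legDirection j +
      (max (-T.legCoord j x) 0 - max (-T.legCoord j y) 0 +
        (Metric.infDist x (T.otherEdges j) - Metric.infDist y (T.otherEdges j))) •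
          legDirection (j + 1) := by
  simp only [tripodalImage, tripodPoint_eq, edgeDirection_eq_add]
  module

theorem le_and_le_of_sq_le {a D : ℝ} (ha : 0 ≤ a) (hD : 0 ≤ D)
    (h1 : (√3 / 4 * D) ^ 2 ≤ a ^ 2) (h2 : a ^ 2 ≤ 7 * D ^ 2) :
    √3 / 4 * D ≤ a ∧ a ≤ √7 * D := by
  refine ⟨le_of_sq_le_sq h1 ha, le_of_sq_le_sq ?_ (by positivity)⟩
  rwa [mul_pow, Real.sq_sqrt (by norm_num)]

theorem dist_tripodalImage_of_same (hx : x ∈ T.edge j) (hy : y ∈ T.edge j) :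
    √3 / 4 * dist x y ≤ dist (T.tripodalImage j x) (T.tripodalImage j y) ∧
      dist (T.tripodalImage j x) (T.tripodalImage j y) ≤ √7 * dist x y := by
  have hD := dist_eq_of_mem_edge hx hy
  have hm : |Metric.infDist x (T.otherEdges j) - Metric.infDist y (T.otherEdges j)| ≤
      dist x y := by
    simpa [Real.dist_eq] using (Metric.lipschitz_infDist_pt (T.otherEdges j)).dist_le_mul x y
  have h1 := abs_max_sub_max_le_abs (T.legCoord j x) (T.legCoord j y) 0
  have h2 := abs_max_sub_max_le_abs (-T.legCoord j x) (-T.legCoord j y) 0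
  rw [neg_sub_neg, abs_sub_comm (T.legCoord j y)] at h2
  have hsub (c : ℝ) : max c 0 - max (-c) 0 = c := max_zero_sub_eq_self c
  have hdx := hsub (T.legCoord j x)
  have hdy := hsub (T.legCoord j y)
  rw [dist_eq_norm (T.tripodalImage j x), tripodalImage_sub_of_same]
  rw [← hD] at h1 h2
  generalize Metric.infDist x (T.otherEdges j) - Metric.infDist y (T.otherEdges j) = m at *
  obtain ⟨u, hu⟩ : ∃ u, u = max (T.legCoord j x) 0 - max (T.legCoord j y) 0 := ⟨_, rfl⟩
  obtain ⟨v, hv⟩ : ∃ v, v = max (-T.legCoord j x) 0 - max (-T.legCoord j y) 0 := ⟨_, rfl⟩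
  rw [← hu] at h1 ⊢
  rw [← hv] at h2 ⊢
  have huv : T.legCoord j x - T.legCoord j y = u - v := by linarith
  rw [huv] at hD
  have hD0 : 0 ≤ dist x y := dist_nonneg
  have hU : |u + m| ≤ 2 * dist x y := (abs_add_le u m).trans (by linarith)
  have hV : |v + m| ≤ 2 * dist x y := (abs_add_le v m).trans (by linarith)
  refine le_and_le_of_sq_le (norm_nonneg _) hD0 ?_ ?_ <;> rw [norm_sq_smul_legDirection_add]
  · refine sq_add_sq_sub_mul_ge hD0 (Or.inr (Or.inr ?_))
    rw [add_sub_add_right_eq_sub, ← hD]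
    linarith
  -- With `U = u + m` and `V = v + m`, the form is `(U - V)² + UV ≤ D² + 4D²`.
  · have h3 : (u - v) ^ 2 = dist x y ^ 2 := by rw [hD, sq_abs]
    have h4 := (le_abs_self _).trans ((abs_mul (u + m) (v + m)).trans_le
      (mul_le_mul hU hV (abs_nonneg _) (by linarith)))
    nlinarith [sq_nonneg (dist x y)]

theorem dist_tripodalImage_of_adjacent (hx : x ∈ T.edge j) (hy : y ∈ T.edge (j + 1)) :
    √3 / 4 * dist x y ≤ dist (T.tripodalImage j x) (T.tripodalImage (j + 1) y) ∧
      dist (T.tripodalImage j x) (T.tripodalImage (j + 1) y) ≤ √7 * dist x y := by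
  have hxD : Metric.infDist x (T.otherEdges j) ≤ dist x y :=
    Metric.infDist_le_dist_of_mem (Or.inl hy)
  have hyD : Metric.infDist y (T.otherEdges (j + 1)) ≤ dist x y := by
    rw [dist_comm]
    refine Metric.infDist_le_dist_of_mem (Or.inr ?_)
    rwa [add_one_add_two]
  rw [dist_eq_norm (T.tripodalImage j x), tripodalImage_sub_of_adjacent]
  refine le_and_le_of_sq_le (norm_nonneg _) dist_nonneg ?_ ?_ <;>
    rw [norm_sq_smul_legDirection_add]
  · refine sq_add_sq_sub_mul_ge dist_nonneg ?_
    obtain ⟨z, hz, hxz⟩ := exists_infDist_eq_dist (T := T) j x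
    obtain ⟨w, hw, hyw⟩ := exists_infDist_eq_dist (T := T) (j + 1) y
    rw [add_one_add_one, add_one_add_two] at hw
    rw [hxz, hyw]
    have hz' : dist x y ≤ 2 * dist x z + |T.legCoord j x + T.legCoord (j + 1) y| ∨
        z ∈ T.edge (j + 2) ∧ |T.legCoord (j + 2) z + T.legCoord j x| ≤ dist x z ∧
          T.legCoord (j + 2) z - T.legCoord j x ≤ dist x z := by
      refine hz.imp (le_two_mul_dist_add_left hx hy) fun hz => ⟨hz, ?_⟩
      have h1 := abs_legCoord_add_legCoord_le (y := x) hz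
      have h2 := legCoord_sub_legCoord_le (j := j + 2) (x := z) (y := x)
        (by rwa [add_two_add_one])
      rw [add_two_add_one, dist_comm] at h1 h2
      exact ⟨h1, h2⟩
    have hw' : dist x y ≤ 2 * dist y w + |T.legCoord j x + T.legCoord (j + 1) y| ∨
        w ∈ T.edge (j + 2) ∧ |T.legCoord (j + 1) y + T.legCoord (j + 2) w| ≤ dist y w ∧
          T.legCoord (j + 1) y - T.legCoord (j + 2) w ≤ dist y w := by
      refine hw.symm.imp (le_two_mul_dist_add_right hx) fun hw => ⟨hw, ?_⟩
      have h1 := abs_legCoord_add_legCoord_le (y := w) hy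
      have h2 := legCoord_sub_legCoord_le (j := j + 1) (x := y) (y := w)
        (by rwa [add_one_add_one])
      rw [add_one_add_one] at h1 h2
      exact ⟨h1, h2⟩
    -- What remains matters only if both nearest points lie on the third edge: then the path `x, z,
    -- w, y` has length `h + |z - w| + k`.
    refine le_two_mul_abs_of_adjacent dist_nonneg dist_nonneg (z := T.legCoord (j + 2) z)
      (w := T.legCoord (j + 2) w) (hz'.imp_right And.right) (hw'.imp_right And.right) ?_
    rcases hz' with h | ⟨hz, -⟩
    · exact Or.inl h
    rcases hw' with h | ⟨hw, -⟩
    · exact Or.inr (Or.inl h)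
    refine Or.inr (Or.inr ?_)
    have h1 := dist_triangle4 x z w y
    rw [dist_eq_of_mem_edge hz hw, dist_comm w] at h1
    linarith
  · exact sq_add_sq_sub_mul_le_of_adjacent Metric.infDist_nonneg Metric.infDist_nonneg hxD hyD
      (abs_legCoord_add_legCoord_le hx) (legCoord_sub_legCoord_le hy)

theorem dist_tripodalImage {i : Fin 3} (hx : x ∈ T.edge i) (hy : y ∈ T.edge j) :
    √3 / 4 * dist x y ≤ dist (T.tripodalImage i x) (T.tripodalImage j y) ∧
      dist (T.tripodalImage i x) (T.tripodalImage j y) ≤ √7 * dist x y := by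
  have hij : i = j ∨ j = i + 1 ∨ i = j + 1 := by
    clear hx hy
    revert i j
    decide
  rcases hij with rfl | rfl | rfl
  · exact dist_tripodalImage_of_same hx hy
  · exact dist_tripodalImage_of_adjacent hx hy
  · rw [dist_comm x, dist_comm (T.tripodalImage (j + 1) x)]
    exact dist_tripodalImage_of_adjacent hy hx

theorem exists_mem_edge (T : MetricTriangle X) (x : X) : ∃ j, x ∈ T.edge j := by
  obtain ⟨j, s, hs, rfl⟩ := T.cover x
  exact ⟨j, s, hs, rfl⟩

theorem exists_isTripodalEmbedding (T : MetricTriangle X) :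
    ∃ F : X → EuclideanSpace ℝ (Fin 2), T.IsTripodalEmbedding F ∧
      ∀ x y, √3 / 4 * dist x y ≤ dist (F x) (F y) ∧ dist (F x) (F y) ≤ √7 * dist x y := by
  choose e he using T.exists_mem_edge
  refine ⟨fun x => T.tripodalImage (e x) x, fun j x hx => ?_,
    fun x y => dist_tripodalImage (he x) (he y)⟩
  -- Both arguments are the same point `x`, seen on the chosen edge and on the edge `j`.
  have h := (dist_tripodalImage (he x) hx).2
  rw [dist_self, mul_zero] at h
  exact dist_le_zero.1 h

end MetricPolygon

/-! ### Distortion and conclusion -/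

theorem distortion_le_mul {X Y : Type*} [MetricSpace X] [MetricSpace Y] {f : X → Y} {a b : ℝ}
    (ha : 0 < a) (hb : 0 < b) (hfa : ∀ x y, a⁻¹ * dist x y ≤ dist (f x) (f y))
    (hfb : ∀ x y, dist (f x) (f y) ≤ b * dist x y) : distortion f ≤ a * b :=
  mul_le_mul (csInf_le ⟨0, fun _ h => h.1.le⟩ ⟨ha, hfa⟩) (csInf_le ⟨0, fun _ h => h.1.le⟩ ⟨hb, hfb⟩)
    (Real.sInf_nonneg fun _ h => h.1.le) ha.le

theorem isBiLipschitz_of_le {X Y : Type*} [MetricSpace X] [MetricSpace Y] {f : X → Y} {a b : ℝ}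
    (ha : 0 < a) (hfa : ∀ x y, a⁻¹ * dist x y ≤ dist (f x) (f y))
    (hfb : ∀ x y, dist (f x) (f y) ≤ b * dist x y) : IsBiLipschitz f := by
  refine ⟨max a b, lt_max_of_lt_left ha, fun x y => ⟨le_trans ?_ (hfa x y), (hfb x y).trans ?_⟩⟩
  · gcongr
    exact le_max_left a b
  · gcongr
    exact le_max_right a b

theorem theorem1p1 {X : Type*} [MetricSpace X] (T : MetricTriangle X) :
    ∃ F : X → EuclideanSpace ℝ (Fin 2),
      T.IsTripodalEmbedding F ∧ IsBiLipschitz F ∧ distortion F ≤ 4 * √(7 / 3) := by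
  obtain ⟨F, hF, hdist⟩ := T.exists_isTripodalEmbedding
  have h3 : 0 < 4 / √3 := by positivity
  have hlow (x y : X) : (4 / √3)⁻¹ * dist x y ≤ dist (F x) (F y) := by
    rw [inv_div]
    exact (hdist x y).1
  refine ⟨F, hF, isBiLipschitz_of_le h3 hlow fun x y => (hdist x y).2,
    (distortion_le_mul h3 (by positivity) hlow fun x y => (hdist x y).2).trans_eq ?_⟩
  rw [Real.sqrt_div (by norm_num)]
  ring
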